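/- Let $X$ be a compact metric space, let $\varphi : X \to X$ be a homeomorphism and let $F : X \to \mathbb{R}$ be continuous. Let $C(X)\rtimes_\varphi\mathbb{Z}$ be the crossed product, that is, the universal unital $C^*$-algebra generated by a copy of $C(X)$ and a unitary $U$ such that $UfU^* = f\circ\varphi^{-1}$ for all $f \in C(X)$. Let $\alpha^F = (\alpha^F_t)_{t\in\mathbb{R}}$ be the flow (continuous one-parameter group of $*$-automorphisms) on $C(X)\rtimes_\varphi\mathbb{Z}$ determined by $\alpha^F_t(fU) = fUe^{-itF}$ for all $f\in C(X)$, $t \in \mathbb{R}$. A flow $\alpha$ on a unital $C^*$-algebra $B$ is called inner when there is a self-adjoint element $h\in B$ such that $\alpha_t(a) = e^{ith}ae^{-ith}$ for all $a\in B$ and $t\in\mathbb{R}$. Then the following conditions are equivalent: 1. The flow $\alpha^F$ is inner. 2. There is a real-valued function $h\in C(X)$ such that $\alpha^F_t = \operatorname{Ad} e^{ith}$ for all $t\in\mathbb{R}$, i.e. $\alpha^F_t(a) = e^{ith}ae^{-ith}$ for all $a \in C(X)\rtimes_\varphi\mathbb{Z}$ and $t \in \mathbb{R}$. 3. There is a continuous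 function $h : X\to\mathbb{R}$ such that $F = h\circ\varphi - h$. -/

import Mathlib

set_option linter.unusedSectionVars false

noncomputable section

namespace ZCrossedProduct

universe u v

/-! ## The algebraic crossed product of `C(X)` by `ℤ` -/

section Algebraic

variable {X : Type u} [TopologicalSpace X] [CompactSpace X]

/-- The algebra `C(X)`, regarded as carrying the action of `ℤ` defined by the homeomorphism `φ`
(a type synonym of `C(X, ℂ)`). -/
def Coef (_φ : X ≃ₜ X) : Type u := C(X, ℂ)

instance (φ : X ≃ₜ X) : CommCStarAlgebra (Coef φ) :=
  inferInstanceAs (CommCStarAlgebra C(X, ℂ))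

/-- The identity map of `C(X)` to its type synonym. -/
def toCoef (φ : X ≃ₜ X) : C(X, ℂ) ≃⋆ₐ[ℂ] Coef φ where
  __ := Equiv.refl C(X, ℂ)
  map_mul' _ _ := rfl
  map_add' _ _ := rfl
  map_star' _ := rfl
  map_smul' _ _ := rfl

/-- The integer `n` acts on `C(X)` by `f ↦ f ∘ φ⁻ⁿ`. -/
instance (φ : X ≃ₜ X) : MulSemiringAction (Multiplicative ℤ) (Coef φ) where
  smul n f := ContinuousMap.comp f ((φ ^ (-n.toAdd) : X ≃ₜ X) : C(X, X))
  one_smul _ := rfl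
  mul_smul m n f := by
    change C(X, ℂ) at f
    refine ContinuousMap.ext fun x => ?_
    change (f : C(X, ℂ)) ((φ ^ (-(m.toAdd + n.toAdd)) : X ≃ₜ X) x) =
      (f : C(X, ℂ)) ((φ ^ (-n.toAdd) : X ≃ₜ X) ((φ ^ (-m.toAdd) : X ≃ₜ X) x))
    rw [neg_add_rev, zpow_add]
    rfl
  smul_zero _ := rfl
  smul_add _ _ _ := rfl
  smul_one _ := rfl
  smul_mul _ _ _ := rfl

instance (φ : X ≃ₜ X) : SMulCommClass (Multiplicative ℤ) ℂ (Coef φ) where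
  smul_comm _ _ _ := rfl

theorem smul_star_coef {φ : X ≃ₜ X} (n : Multiplicative ℤ) (f : Coef φ) :
    n • star f = star (n • f) := rfl

theorem smul_toCoef {φ : X ≃ₜ X} (n : Multiplicative ℤ) (f : C(X, ℂ)) :
    n • toCoef φ f = toCoef φ (f.comp ((φ ^ (-n.toAdd) : X ≃ₜ X) : C(X, X))) := rfl

theorem norm_toCoef {φ : X ≃ₜ X} (f : C(X, ℂ)) : ‖toCoef φ f‖ = ‖f‖ := rfl

theorem norm_smul_coef_le {φ : X ≃ₜ X} (n : Multiplicative ℤ) (f : Coef φ) :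
    ‖n • f‖ ≤ ‖f‖ := by
  refine (ContinuousMap.norm_le (α := X) (E := ℂ) (n • f : Coef φ) (norm_nonneg f)).2 fun x => ?_
  exact ContinuousMap.norm_coe_le_norm (α := X) (E := ℂ) f _

/-- Finite sums `∑ fₙ Uⁿ` with `fₙ ∈ C(X)`, multiplied by the rule `U f = (f ∘ φ⁻¹) U`;
`SkewMonoidAlgebra.single n f` is the monomial `f Uⁿ`. -/
abbrev Alg (φ : X ≃ₜ X) : Type u := SkewMonoidAlgebra (Coef φ) (Multiplicative ℤ)

open SkewMonoidAlgebra

variable {φ : X ≃ₜ X}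

/-- The involution of `Alg φ` as an additive map: `(f Uⁿ)* = U⁻ⁿ f̄ = (f̄ ∘ φⁿ) U⁻ⁿ`. -/
def starAddHom (φ : X ≃ₜ X) : Alg φ →+ Alg φ where
  toFun a := a.sum fun n f => single n⁻¹ (n⁻¹ • star f)
  map_zero' := sum_zero_index
  map_add' a b := sum_add_index' (by simp) (by simp)

theorem starAddHom_single (n : Multiplicative ℤ) (f : Coef φ) :
    starAddHom φ (single n f) = single n⁻¹ (n⁻¹ • star f) :=
  sum_single_index (h := fun n (f : Coef φ) => (single n⁻¹ (n⁻¹ • star f) : Alg φ)) (by simp)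

theorem alg_induction {p : Alg φ → Prop} (a : Alg φ) (h0 : p 0)
    (hs : ∀ n f, p (single n f)) (ha : ∀ a b, p a → p b → p (a + b)) : p a :=
  SkewMonoidAlgebra.induction_on a h0 hs ha

instance : StarRing (Alg φ) where
  star := starAddHom φ
  star_involutive a := by
    induction a using alg_induction with
    | h0 => simp
    | hs n f =>
      rw [starAddHom_single, starAddHom_single, ← smul_star_coef]; simp
    | ha a b h1 h2 =>
      change starAddHom φ (starAddHom φ _) = _ at h1 h2
      rw [map_add, map_add, h1, h2]
  star_add a b := map_add (starAddHom φ) a b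
  star_mul a b := by
    change starAddHom φ (a * b) = starAddHom φ b * starAddHom φ a
    induction a using alg_induction with
    | h0 => simp
    | ha a a' h1 h2 => rw [add_mul, map_add, map_add, h1, h2, mul_add]
    | hs n f =>
      induction b using alg_induction with
      | h0 => simp
      | ha a a' h1 h2 => rw [mul_add, map_add, map_add, h1, h2, add_mul]
      | hs m g =>
        rw [single_mul_single, starAddHom_single, starAddHom_single, starAddHom_single,
          single_mul_single, mul_inv_rev, star_mul, ← smul_star_coef, smul_mul', mul_smul,
          mul_smul, inv_smul_smul]

theorem star_single (n : Multiplicative ℤ) (f : Coef φ) :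
    star (single n f : Alg φ) = single n⁻¹ (n⁻¹ • star f) := starAddHom_single n f

instance : StarModule ℂ (Alg φ) where
  star_smul c a := by
    induction a using alg_induction with
    | h0 => simp
    | hs n f =>
      rw [smul_single, star_single, star_single, star_smul, smul_single, smul_comm]
    | ha a b h1 h2 => simp [smul_add, h1, h2]

/-! ## The universal C⋆-norm -/

/-- `p` is a C⋆-seminorm on `Alg φ`, normalised so that `p (f Uⁿ) ≤ ‖f‖`. Every ⋆-homomorphism
of `Alg φ` into a C⋆-algebra defines such a `p`. -/
structure IsCStarSeminorm (p : Seminorm ℂ (Alg φ)) : Prop where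
  mul_le : ∀ a b, p (a * b) ≤ p a * p b
  star_mul_self : ∀ a, p (star a * a) = p a * p a
  single_le : ∀ n f, p (single n f) ≤ ‖f‖

/-- The type of C⋆-seminorms. -/
abbrev CStarSeminorms (φ : X ≃ₜ X) : Type u := {p : Seminorm ℂ (Alg φ) // IsCStarSeminorm p}

instance : Nonempty (CStarSeminorms φ) :=
  ⟨0, ⟨by simp, by simp, by simp⟩⟩

/-- The universal norm: the supremum of all C⋆-seminorms. -/
def uNorm (a : Alg φ) : ℝ := ⨆ p : CStarSeminorms φ, p.1 a

theorem bddAbove_seminorms (a : Alg φ) :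
    BddAbove (Set.range fun p : CStarSeminorms φ => p.1 a) := by
  induction a using alg_induction with
  | h0 => exact ⟨0, by rintro _ ⟨p, rfl⟩; simp⟩
  | hs n f => exact ⟨‖f‖, by rintro _ ⟨p, rfl⟩; exact p.2.single_le n f⟩
  | ha a b h1 h2 =>
    obtain ⟨M, hM⟩ := h1
    obtain ⟨N, hN⟩ := h2
    refine ⟨M + N, ?_⟩
    rintro _ ⟨p, rfl⟩
    exact (map_add_le_add p.1 a b).trans (add_le_add (hM ⟨p, rfl⟩) (hN ⟨p, rfl⟩))

theorem le_uNorm (p : CStarSeminorms φ) (a : Alg φ) : p.1 a ≤ uNorm a :=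
  le_ciSup (bddAbove_seminorms a) p

theorem uNorm_nonneg (a : Alg φ) : 0 ≤ uNorm a :=
  Real.iSup_nonneg fun p => apply_nonneg p.1 a

theorem uNorm_mul_le (a b : Alg φ) : uNorm (a * b) ≤ uNorm a * uNorm b :=
  ciSup_le fun p => (p.2.mul_le a b).trans
    (mul_le_mul (le_uNorm p a) (le_uNorm p b) (apply_nonneg _ _) (uNorm_nonneg _))

theorem uNorm_single_le (n : Multiplicative ℤ) (f : Coef φ) :
    uNorm (single n f : Alg φ) ≤ ‖f‖ := ciSup_le fun p => p.2.single_le n f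

theorem uNorm_mul_self_le (a : Alg φ) : uNorm a * uNorm a ≤ uNorm (star a * a) := by
  have h : uNorm a ≤ √(uNorm (star a * a)) := ciSup_le fun p =>
    Real.le_sqrt_of_sq_le (by rw [sq, ← p.2.star_mul_self]; exact le_uNorm p _)
  exact (mul_self_le_mul_self (uNorm_nonneg a) h).trans_eq (Real.mul_self_sqrt (uNorm_nonneg _))

/-- The universal norm as a bundled seminorm of the additive group. -/
def uSeminorm (φ : X ≃ₜ X) : AddGroupSeminorm (Alg φ) where
  toFun := uNorm
  map_zero' := by simp [uNorm]
  add_le' a b := ciSup_le fun p => (map_add_le_add p.1 a b).trans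
    (add_le_add (le_uNorm p a) (le_uNorm p b))
  neg' a := by simp [uNorm]

instance : SeminormedAddCommGroup (Alg φ) := (uSeminorm φ).toSeminormedAddCommGroup

instance : SeminormedRing (Alg φ) where
  __ := (inferInstance : SeminormedAddCommGroup (Alg φ))
  __ := (inferInstance : Ring (Alg φ))
  norm_mul_le := uNorm_mul_le

theorem norm_alg (a : Alg φ) : ‖a‖ = uNorm a := rfl

instance : NormedSpace ℂ (Alg φ) where
  norm_smul_le c a := ciSup_le fun p => by
    rw [map_smul_eq_mul]
    exact mul_le_mul_of_nonneg_left (le_uNorm p a) (norm_nonneg c)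

instance : NormedAlgebra ℂ (Alg φ) where
  norm_smul_le := norm_smul_le

theorem norm_le_norm_star (a : Alg φ) : ‖a‖ ≤ ‖star a‖ := by
  have h : ‖a‖ * ‖a‖ ≤ ‖star a‖ * ‖a‖ := (uNorm_mul_self_le a).trans (uNorm_mul_le _ _)
  rcases (norm_nonneg a).eq_or_lt with h0 | h0
  · rw [← h0]; exact norm_nonneg _
  · exact le_of_mul_le_mul_right h h0

instance : NormedStarGroup (Alg φ) where
  norm_star_le a := by simpa using norm_le_norm_star (star a)

theorem uniformContinuous_star_alg : UniformContinuous (star : Alg φ → Alg φ) :=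
  uniformContinuous_addMonoidHom_of_continuous (f := starAddHom φ) continuous_star

end Algebraic

/-! ## The crossed product C⋆-algebra -/

section CrossedProduct

variable {X : Type u} [TopologicalSpace X] [CompactSpace X]

open SkewMonoidAlgebra UniformSpace

/-- The crossed product C⋆-algebra `C(X) ⋊_φ ℤ`: the (Hausdorff) completion of the algebraic
crossed product in the universal C⋆-norm. -/
def CrossedProduct (φ : X ≃ₜ X) : Type u := Completion (Alg φ)

variable {φ : X ≃ₜ X}

instance : NormedRing (CrossedProduct φ) := inferInstanceAs (NormedRing (Completion (Alg φ)))

instance : CompleteSpace (CrossedProduct φ) := inferInstanceAs (CompleteSpace (Completion (Alg φ)))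

instance : Algebra ℂ (CrossedProduct φ) := inferInstanceAs (Algebra ℂ (Completion (Alg φ)))

instance : NormedAlgebra ℂ (CrossedProduct φ) where
  norm_smul_le := norm_smul_le (α := ℂ) (β := Completion (Alg φ))

/-- The canonical map of the algebraic crossed product into the crossed product. -/
def toCP (φ : X ≃ₜ X) : Alg φ →ₐ[ℂ] CrossedProduct φ where
  __ := (Completion.coeRingHom : Alg φ →+* Completion (Alg φ))
  commutes' _ := rfl

theorem norm_toCP (a : Alg φ) : ‖toCP φ a‖ = ‖a‖ := Completion.norm_coe a

theorem continuous_toCP : Continuous (toCP φ) := Completion.continuous_coe (Alg φ)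

theorem denseRange_toCP : DenseRange (toCP φ) := Completion.denseRange_coe

theorem cp_induction {p : CrossedProduct φ → Prop} (x : CrossedProduct φ)
    (hp : IsClosed {x | p x}) (h : ∀ a, p (toCP φ a)) : p x :=
  denseRange_toCP.induction_on x hp h

instance : Star (CrossedProduct φ) where
  star := Completion.map (star : Alg φ → Alg φ)

theorem star_toCP (a : Alg φ) : star (toCP φ a) = toCP φ (star a) :=
  Completion.map_coe uniformContinuous_star_alg a

theorem continuous_star_cp : Continuous (star : CrossedProduct φ → CrossedProduct φ) :=
  Completion.continuous_map

instance : StarRing (CrossedProduct φ) where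
  star_involutive x := by
    induction x using cp_induction with
    | hp => exact isClosed_eq (continuous_star_cp.comp continuous_star_cp) continuous_id
    | h a => rw [star_toCP, star_toCP, star_star]
  star_add x y := by
    induction x using cp_induction with
    | hp =>
      exact isClosed_eq (continuous_star_cp.comp (continuous_id.add continuous_const))
        (continuous_star_cp.add continuous_const)
    | h a =>
      induction y using cp_induction with
      | hp =>
        exact isClosed_eq (continuous_star_cp.comp (continuous_const.add continuous_id))
          (continuous_const.add continuous_star_cp)
      | h b => rw [← map_add, star_toCP, star_toCP, star_toCP, star_add, map_add]
  star_mul x y := by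
    induction x using cp_induction with
    | hp =>
      exact isClosed_eq (continuous_star_cp.comp (continuous_id.mul continuous_const))
        (continuous_const.mul continuous_star_cp)
    | h a =>
      induction y using cp_induction with
      | hp =>
        exact isClosed_eq (continuous_star_cp.comp (continuous_const.mul continuous_id))
          (continuous_star_cp.mul continuous_const)
      | h b => rw [← map_mul, star_toCP, star_toCP, star_toCP, star_mul, map_mul]

instance : StarModule ℂ (CrossedProduct φ) where
  star_smul c x := by
    induction x using cp_induction with
    | hp =>
      exact isClosed_eq (continuous_star_cp.comp (continuous_const_smul c))
        (continuous_star_cp.const_smul (star c))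
    | h a => rw [← map_smul, star_toCP, star_toCP, star_smul, map_smul]

instance : CStarRing (CrossedProduct φ) where
  norm_mul_self_le x := by
    induction x using cp_induction with
    | hp =>
      exact isClosed_le (continuous_norm.mul continuous_norm)
        ((continuous_star_cp.mul continuous_id).norm)
    | h a =>
      rw [star_toCP, ← map_mul, norm_toCP, norm_toCP]
      exact uNorm_mul_self_le a

instance : CStarAlgebra (CrossedProduct φ) where

/-- The canonical map `C(X) → C(X) ⋊_φ ℤ`. -/
def ofFun (φ : X ≃ₜ X) : C(X, ℂ) →⋆ₐ[ℂ] CrossedProduct φ where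
  toFun f := toCP φ (single 1 (toCoef φ f))
  map_one' := by rw [map_one, single_one_one, map_one]
  map_mul' f g := by
    rw [← map_mul (toCP φ), single_mul_single, one_smul, one_mul, map_mul]
  map_zero' := by rw [map_zero, single_zero, map_zero]
  map_add' f g := by rw [← map_add (toCP φ), ← single_add, map_add]
  commutes' c := (toCP φ).commutes c
  map_star' f := by
    rw [star_toCP, star_single, inv_one, one_smul, map_star]

theorem ofFun_apply (f : C(X, ℂ)) : ofFun φ f = toCP φ (single 1 (toCoef φ f)) := rfl

theorem toCP_single_mem_unitary (n : Multiplicative ℤ) :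
    toCP φ (single n 1) ∈ unitary (CrossedProduct φ) := by
  rw [Unitary.mem_iff, star_toCP, star_single, ← map_mul, ← map_mul, single_mul_single,
    single_mul_single]
  simp

/-- The canonical unitary `U` of `C(X) ⋊_φ ℤ`. -/
def U (φ : X ≃ₜ X) : unitary (CrossedProduct φ) :=
  ⟨toCP φ (single (Multiplicative.ofAdd 1) 1), toCP_single_mem_unitary _⟩

theorem coe_U : (U φ : CrossedProduct φ) = toCP φ (single (Multiplicative.ofAdd 1) 1) := rfl

/-- The defining relation `U f U* = f ∘ φ⁻¹`. -/
theorem U_mul_ofFun_mul_star (f : C(X, ℂ)) :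
    (U φ : CrossedProduct φ) * ofFun φ f * star (U φ : CrossedProduct φ) =
      ofFun φ (f.comp (φ.symm : C(X, X))) := by
  rw [coe_U, ofFun_apply, star_toCP, star_single, ← map_mul, ← map_mul, single_mul_single,
    single_mul_single]
  simp
  rfl

theorem coe_U_zpow (n : ℤ) :
    ((U φ ^ n : unitary (CrossedProduct φ)) : CrossedProduct φ) =
      toCP φ (single (Multiplicative.ofAdd n) 1) := by
  let g : Multiplicative ℤ →* unitary (CrossedProduct φ) :=
    { toFun := fun n => ⟨toCP φ (single n 1), toCP_single_mem_unitary n⟩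
      map_one' := Subtype.ext (map_one (toCP φ))
      map_mul' := fun m n => Subtype.ext <| by
        change toCP φ (single (m * n) 1) = toCP φ (single m 1) * toCP φ (single n 1)
        rw [← map_mul, single_mul_single, smul_one, one_mul] }
  have h : U φ ^ n = g (Multiplicative.ofAdd n) := by
    have : U φ = g (Multiplicative.ofAdd 1) := rfl
    rw [this, ← map_zpow, ← ofAdd_zsmul, smul_eq_mul, mul_one]
  rw [h]
  rfl

theorem toCP_single (n : Multiplicative ℤ) (f : C(X, ℂ)) :
    toCP φ (single n (toCoef φ f)) =
      ofFun φ f * ((U φ ^ n.toAdd : unitary (CrossedProduct φ)) : CrossedProduct φ) := by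
  rw [coe_U_zpow, ofFun_apply, ← map_mul, single_mul_single]
  simp

theorem norm_ofFun_le (f : C(X, ℂ)) : ‖ofFun φ f‖ ≤ ‖f‖ := by
  rw [ofFun_apply, norm_toCP]
  exact uNorm_single_le _ _

/-! ## The universal property -/

section Universal

variable {B : Type v} [CStarAlgebra B]

/-- A covariant pair: a unital ⋆-homomorphism `π : C(X) → B` and a unitary `V` of `B` with
`V π(f) V* = π(f ∘ φ⁻¹)`. -/
def IsCovariant (φ : X ≃ₜ X) (π : C(X, ℂ) →⋆ₐ[ℂ] B) (V : unitary B) : Prop :=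
  ∀ f : C(X, ℂ), (V : B) * π f * star (V : B) = π (f.comp (φ.symm : C(X, X)))

variable {π : C(X, ℂ) →⋆ₐ[ℂ] B} {V : unitary B}

theorem IsCovariant.conj_zpow (h : IsCovariant φ π V) (n : ℤ) (f : C(X, ℂ)) :
    ((V ^ n : unitary B) : B) * π f =
      π (f.comp ((φ ^ (-n) : X ≃ₜ X) : C(X, X))) * ((V ^ n : unitary B) : B) := by
  have h1 : ∀ g, (V : B) * π g = π (g.comp (φ.symm : C(X, X))) * V := fun g => by
    rw [← h g, mul_assoc, Unitary.coe_star_mul_self, mul_one]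
  have h2 : ∀ g, star (V : B) * π g = π (g.comp (φ : C(X, X))) * star (V : B) := fun g => by
    have := h (g.comp (φ : C(X, X)))
    rw [ContinuousMap.comp_assoc, Homeomorph.toContinuousMap_comp_symm,
      ContinuousMap.comp_id] at this
    rw [← this, ← mul_assoc, ← mul_assoc, Unitary.coe_star_mul_self, one_mul]
  induction n generalizing f with
  | zero => simp; rfl
  | succ n ih =>
    rw [zpow_add_one, Submonoid.coe_mul, mul_assoc, h1, ← mul_assoc, ih, mul_assoc]
    congr 2
    refine ContinuousMap.ext fun x => congrArg f ?_
    rw [neg_add_rev, zpow_add, zpow_neg_one]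
    rfl
  | pred n ih =>
    rw [zpow_sub_one, Submonoid.coe_mul, mul_assoc, ← Unitary.star_eq_inv, Unitary.coe_star, h2,
      ← mul_assoc, ih, mul_assoc]
    congr 2
    refine ContinuousMap.ext fun x => congrArg f ?_
    rw [neg_sub', sub_neg_eq_add, add_comm, zpow_add, zpow_one]
    rfl

/-- The homomorphism `∑ fₙ Uⁿ ↦ ∑ π(fₙ) Vⁿ` of the algebraic crossed product defined by a
covariant pair. -/
def liftAlgHom (h : IsCovariant φ π V) : Alg φ →ₐ[ℂ] B :=
  liftNCAlgHom (π.toAlgHom.comp (toCoef φ).symm.toStarAlgHom.toAlgHom)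
    ((unitary B).subtype.comp (zpowersHom (unitary B) V))
    (fun {f n} => (h.conj_zpow n.toAdd ((toCoef φ).symm f)).symm)

theorem liftAlgHom_single (h : IsCovariant φ π V) (n : Multiplicative ℤ) (f : C(X, ℂ)) :
    liftAlgHom h (single n (toCoef φ f)) = π f * ((V ^ n.toAdd : unitary B) : B) :=
  SkewMonoidAlgebra.liftNC_single _ _ _ _

theorem toCoef_surjective (f : Coef φ) : ∃ g, toCoef φ g = f := ⟨f, rfl⟩

/-- `liftAlgHom` as a ⋆-homomorphism. -/
def liftAlg (h : IsCovariant φ π V) : Alg φ →⋆ₐ[ℂ] B where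
  __ := liftAlgHom h
  map_star' a := by
    change liftAlgHom h (star a) = star (liftAlgHom h a)
    induction a using alg_induction with
    | h0 => simp
    | hs n f =>
      obtain ⟨f, rfl⟩ := toCoef_surjective f
      rw [star_single, ← map_star, smul_toCoef, liftAlgHom_single, liftAlgHom_single, star_mul,
        ← map_star, toAdd_inv, ← h.conj_zpow, zpow_neg, ← Unitary.star_eq_inv, Unitary.coe_star]
    | ha a b h1 h2 => rw [star_add, map_add, map_add, star_add, h1, h2]

theorem liftAlg_single (h : IsCovariant φ π V) (n : Multiplicative ℤ) (f : C(X, ℂ)) :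
    liftAlg h (single n (toCoef φ f)) = π f * ((V ^ n.toAdd : unitary B) : B) :=
  liftAlgHom_single h n f

theorem norm_liftAlg_le (h : IsCovariant φ π V) (a : Alg φ) : ‖liftAlg h a‖ ≤ ‖a‖ := by
  let p : Seminorm ℂ (Alg φ) := (normSeminorm ℂ B).comp (liftAlg h).toAlgHom.toLinearMap
  have hp : ∀ a, p a = ‖liftAlg h a‖ := fun _ => rfl
  refine le_uNorm ⟨p, ⟨fun a b => ?_, fun a => ?_, fun n f => ?_⟩⟩ a
  · rw [hp, hp, hp, map_mul]; exact norm_mul_le _ _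
  · rw [hp, hp, map_mul, map_star]; exact CStarRing.norm_star_mul_self
  · rw [hp]
    obtain ⟨f, rfl⟩ := toCoef_surjective f
    rw [liftAlg_single, CStarRing.norm_mul_coe_unitary, norm_toCoef]
    exact NonUnitalStarAlgHom.norm_apply_le π f

theorem uniformContinuous_liftAlg (h : IsCovariant φ π V) : UniformContinuous (liftAlg h) :=
  (AddMonoidHomClass.lipschitz_of_bound (liftAlg h) 1
    fun a => by simpa using norm_liftAlg_le h a).uniformContinuous

/-- The ring homomorphism extending `liftAlg h` to `C(X) ⋊_φ ℤ`. -/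
def liftRingHom (h : IsCovariant φ π V) : CrossedProduct φ →+* B :=
  Completion.extensionHom (liftAlg h).toAlgHom.toRingHom (uniformContinuous_liftAlg h).continuous

theorem continuous_liftRingHom (h : IsCovariant φ π V) : Continuous (liftRingHom h) :=
  Completion.continuous_extension

theorem liftRingHom_toCP (h : IsCovariant φ π V) (a : Alg φ) :
    liftRingHom h (toCP φ a) = liftAlg h a :=
  Completion.extensionHom_coe _ (uniformContinuous_liftAlg h).continuous a

/-- The ⋆-homomorphism `C(X) ⋊_φ ℤ → B` defined by a covariant pair. -/
def lift (h : IsCovariant φ π V) : CrossedProduct φ →⋆ₐ[ℂ] B where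
  __ := liftRingHom h
  commutes' c := by
    change liftRingHom h (algebraMap ℂ _ c) = _
    rw [← (toCP φ).commutes c, liftRingHom_toCP, AlgHomClass.commutes]
  map_star' x := by
    change liftRingHom h (star x) = star (liftRingHom h x)
    induction x using cp_induction with
    | hp =>
      exact isClosed_eq ((continuous_liftRingHom h).comp continuous_star_cp)
        (continuous_liftRingHom h).star
    | h a => rw [star_toCP, liftRingHom_toCP, liftRingHom_toCP, map_star]

theorem lift_toCP (h : IsCovariant φ π V) (a : Alg φ) : lift h (toCP φ a) = liftAlg h a :=
  liftRingHom_toCP h a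

theorem lift_ofFun (h : IsCovariant φ π V) (f : C(X, ℂ)) : lift h (ofFun φ f) = π f := by
  rw [ofFun_apply, lift_toCP, liftAlg_single]; simp

theorem lift_U (h : IsCovariant φ π V) : lift h (U φ : CrossedProduct φ) = V := by
  rw [coe_U, lift_toCP, ← map_one (toCoef φ), liftAlg_single]; simp

theorem continuous_hom (ρ : CrossedProduct φ →⋆ₐ[ℂ] B) : Continuous ρ :=
  (AddMonoidHomClass.lipschitz_of_bound ρ 1
    fun a => by simpa using NonUnitalStarAlgHom.norm_apply_le ρ a).continuous

/-- The homomorphism of unitary groups induced by a ⋆-homomorphism. -/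
def unitaryMap {A : Type*} [CStarAlgebra A] (ρ : A →⋆ₐ[ℂ] B) : unitary A →* unitary B where
  toFun u := ⟨ρ u, Unitary.map_mem ρ u.2⟩
  map_one' := Subtype.ext (map_one ρ)
  map_mul' _ _ := Subtype.ext (map_mul ρ _ _)

/-- The image under `ρ` of a monomial. -/
theorem hom_toCP_single (ρ : CrossedProduct φ →⋆ₐ[ℂ] B) (W : unitary B)
    (hW : ρ (U φ : CrossedProduct φ) = W) (n : Multiplicative ℤ) (f : C(X, ℂ)) :
    ρ (toCP φ (single n (toCoef φ f))) = ρ (ofFun φ f) * ((W ^ n.toAdd : unitary B) : B) := by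
  have h : unitaryMap ρ (U φ) = W := Subtype.ext hW
  rw [toCP_single, map_mul, ← h, ← map_zpow]
  rfl

theorem hom_ext {ρ σ : CrossedProduct φ →⋆ₐ[ℂ] B} (h1 : ∀ f, ρ (ofFun φ f) = σ (ofFun φ f))
    (h2 : ρ (U φ : CrossedProduct φ) = σ (U φ : CrossedProduct φ)) : ρ = σ := by
  ext x
  induction x using cp_induction with
  | hp => exact isClosed_eq (continuous_hom ρ) (continuous_hom σ)
  | h a =>
    induction a using alg_induction with
    | h0 => simp
    | hs n f =>
      obtain ⟨f, rfl⟩ := toCoef_surjective f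
      rw [hom_toCP_single ρ (unitaryMap σ (U φ)) h2, hom_toCP_single σ (unitaryMap σ (U φ)) rfl,
        h1]
    | ha a b h1 h2 => rw [map_add, map_add, map_add, h1, h2]

/-- The universal property of `C(X) ⋊_φ ℤ`. -/
theorem existsUnique_lift (h : IsCovariant φ π V) :
    ∃! ρ : CrossedProduct φ →⋆ₐ[ℂ] B,
      (∀ f, ρ (ofFun φ f) = π f) ∧ ρ (U φ : CrossedProduct φ) = V :=
  ⟨lift h, ⟨lift_ofFun h, lift_U h⟩, fun _ hρ => hom_ext
    (fun f => (hρ.1 f).trans (lift_ofFun h f).symm) (hρ.2.trans (lift_U h).symm)⟩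

end Universal

end CrossedProduct

/-! ## Flows -/

section Flows

open SkewMonoidAlgebra

/-- A flow on a unital C⋆-algebra: a (strongly) continuous one-parameter group of
⋆-automorphisms. -/
structure CStarFlow (B : Type v) [CStarAlgebra B] where
  /-- The automorphism at time `t`. -/
  aut : ℝ → (B ≃⋆ₐ[ℂ] B)
  aut_zero : ∀ a, aut 0 a = a
  aut_add : ∀ s t a, aut (s + t) a = aut s (aut t a)
  continuous_aut : ∀ a, Continuous fun t => aut t a

/-- `αₜ = Ad e^{ith}` for all real `t`, that is `αₜ(a) = e^{ith} a e^{-ith}` for all `a`. -/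
def CStarFlow.ImplementedBy {B : Type v} [CStarAlgebra B] (α : CStarFlow B) (h : B) : Prop :=
  ∀ (t : ℝ) (a : B), α.aut t a =
    NormedSpace.exp ((Complex.I * t) • h) * a * NormedSpace.exp (-((Complex.I * t) • h))

/-- A flow is inner when it is of the form `Ad e^{ith}` for a self-adjoint element `h`. -/
def CStarFlow.IsInner {B : Type v} [CStarAlgebra B] (α : CStarFlow B) : Prop :=
  ∃ h : B, IsSelfAdjoint h ∧ α.ImplementedBy h

variable {X : Type u} [TopologicalSpace X] [CompactSpace X]

/-- A real-valued continuous function as an element of `C(X)`. -/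
def toComplex (h : C(X, ℝ)) : C(X, ℂ) := ⟨fun x => (h x : ℂ), by fun_prop⟩

/-- The function `e^{-itF}`, an element of `C(X)`. -/
def phase (F : C(X, ℝ)) (t : ℝ) : C(X, ℂ) :=
  ⟨fun x => Complex.exp (-(Complex.I * t * F x)), by fun_prop⟩

theorem phase_zero (F : C(X, ℝ)) : phase F 0 = 1 := by
  ext x; simp [phase]

theorem phase_add (F : C(X, ℝ)) (s t : ℝ) : phase F (s + t) = phase F s * phase F t := by
  ext x
  simp only [phase, ContinuousMap.coe_mk, ContinuousMap.mul_apply, ← Complex.exp_add]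
  congr 1
  push_cast
  ring

theorem star_phase (F : C(X, ℝ)) (t : ℝ) : star (phase F t) = phase F (-t) := by
  ext x
  simp [phase, ← Complex.exp_conj]

theorem continuous_phase (F : C(X, ℝ)) : Continuous (phase F) := by
  refine ContinuousMap.continuous_of_continuous_uncurry _ ?_
  simp only [phase, Function.uncurry_def, ContinuousMap.coe_mk]
  fun_prop

/-- `e^{-itF}` as a unitary of `C(X)`. -/
def phaseUnitary (F : C(X, ℝ)) (t : ℝ) : unitary C(X, ℂ) :=
  ⟨phase F t, by
    rw [Unitary.mem_iff, star_phase, ← phase_add, ← phase_add]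
    simp [phase_zero]⟩

variable (φ : X ≃ₜ X) (F : C(X, ℝ))

/-- The unitary `U e^{-itF}` of the crossed product. -/
def twistedU (t : ℝ) : unitary (CrossedProduct φ) :=
  U φ * unitaryMap (ofFun φ) (phaseUnitary F t)

theorem coe_twistedU (t : ℝ) : (twistedU φ F t : CrossedProduct φ) =
    (U φ : CrossedProduct φ) * ofFun φ (phase F t) := rfl

theorem isCovariant_twistedU (t : ℝ) : IsCovariant φ (ofFun φ) (twistedU φ F t) := by
  intro f
  rw [coe_twistedU, star_mul, ← map_star, ← U_mul_ofFun_mul_star]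
  have : ofFun φ (phase F t) * ofFun φ f * ofFun φ (star (phase F t)) = ofFun φ f := by
    rw [← map_mul, ← map_mul, mul_right_comm, star_phase, ← phase_add, add_neg_cancel, phase_zero,
      one_mul]
  calc _ = (U φ : CrossedProduct φ) *
        (ofFun φ (phase F t) * ofFun φ f * ofFun φ (star (phase F t))) *
        star (U φ : CrossedProduct φ) := by simp only [mul_assoc]
    _ = _ := by rw [this]

/-- The endomorphism of `C(X) ⋊_φ ℤ` with `f ↦ f` for `f ∈ C(X)` and `U ↦ U e^{-itF}`. -/
def flowHom (t : ℝ) : CrossedProduct φ →⋆ₐ[ℂ] CrossedProduct φ :=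
  lift (isCovariant_twistedU φ F t)

theorem flowHom_ofFun (t : ℝ) (f : C(X, ℂ)) : flowHom φ F t (ofFun φ f) = ofFun φ f :=
  lift_ofFun _ f

theorem flowHom_U (t : ℝ) : flowHom φ F t (U φ : CrossedProduct φ) =
    (U φ : CrossedProduct φ) * ofFun φ (phase F t) := lift_U _

theorem flowHom_zero (a : CrossedProduct φ) : flowHom φ F 0 a = a := by
  have : flowHom φ F 0 = StarAlgHom.id ℂ _ := hom_ext (fun f => flowHom_ofFun φ F 0 f) (by
    rw [flowHom_U, phase_zero, map_one, mul_one]; rfl)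
  rw [this]
  rfl

theorem flowHom_add (s t : ℝ) (a : CrossedProduct φ) :
    flowHom φ F (s + t) a = flowHom φ F s (flowHom φ F t a) := by
  have : flowHom φ F (s + t) = (flowHom φ F s).comp (flowHom φ F t) := hom_ext
    (fun f => by simp only [StarAlgHom.comp_apply, flowHom_ofFun])
    (by rw [StarAlgHom.comp_apply, flowHom_U, flowHom_U, map_mul, flowHom_U, flowHom_ofFun,
      phase_add, map_mul, mul_assoc])
  rw [this]
  rfl

theorem continuous_flowHom (a : CrossedProduct φ) : Continuous fun t => flowHom φ F t a := by
  have hU : Continuous (twistedU φ F) := by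
    refine continuous_induced_rng.2 ?_
    change Continuous fun t => (U φ : CrossedProduct φ) * ofFun φ (phase F t)
    have : Continuous (ofFun φ) := (AddMonoidHomClass.lipschitz_of_bound (ofFun φ) 1
      fun f => by simpa using norm_ofFun_le f).continuous
    exact continuous_const.mul (this.comp (continuous_phase F))
  induction a using cp_induction with
  | hp =>
    rw [← isSeqClosed_iff_isClosed]
    intro x a hx ha
    refine continuous_of_uniform_approx_of_continuous fun u hu => ?_
    obtain ⟨ε, hε, hεu⟩ := Metric.mem_uniformity_dist.1 hu
    obtain ⟨n, hn⟩ := ((Metric.tendsto_nhds.1 ha) ε hε).exists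
    refine ⟨fun t => flowHom φ F t (x n), hx n, fun t => hεu ?_⟩
    rw [dist_eq_norm, ← map_sub]
    refine (NonUnitalStarAlgHom.norm_apply_le (flowHom φ F t) _).trans_lt ?_
    rwa [← dist_eq_norm, dist_comm]
  | h a =>
    induction a using alg_induction with
    | h0 => simpa using continuous_const
    | hs n f =>
      obtain ⟨f, rfl⟩ := toCoef_surjective f
      have h : ∀ t, flowHom φ F t (toCP φ (single n (toCoef φ f))) =
          ofFun φ f * ((twistedU φ F t ^ n.toAdd : unitary (CrossedProduct φ)) :
            CrossedProduct φ) := fun t => by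
        rw [hom_toCP_single _ (twistedU φ F t) (flowHom_U φ F t), flowHom_ofFun]
      simp only [h]
      exact continuous_const.mul (continuous_subtype_val.comp (hU.zpow n.toAdd))
    | ha a b h1 h2 =>
      simp only [map_add]
      exact h1.add h2

/-- The flow `α^F` on `C(X) ⋊_φ ℤ`: the one-parameter group of ⋆-automorphisms with
`α^F_t(f U) = f U e^{-itF}` for `f ∈ C(X)`. -/
def potentialFlow : CStarFlow (CrossedProduct φ) where
  aut t := StarAlgEquiv.ofStarAlgHom (flowHom φ F t) (flowHom φ F (-t))
    (by ext a; simp [← flowHom_add, flowHom_zero])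
    (by ext a; simp [← flowHom_add, flowHom_zero])
  aut_zero := flowHom_zero φ F
  aut_add := flowHom_add φ F
  continuous_aut := continuous_flowHom φ F

/-- The formula that determines the flow `α^F`. -/
theorem potentialFlow_ofFun_mul_U (t : ℝ) (f : C(X, ℂ)) :
    (potentialFlow φ F).aut t (ofFun φ f * (U φ : CrossedProduct φ)) =
      ofFun φ f * (U φ : CrossedProduct φ) * ofFun φ (phase F t) := by
  change flowHom φ F t _ = _
  rw [map_mul, flowHom_ofFun, flowHom_U, mul_assoc]

end Flows

end ZCrossedProduct

end

noncomputable section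

namespace ZCrossedProduct

open SkewMonoidAlgebra

/-! Suppose `α^F = Ad e^{ith}` with `h` anywhere in the crossed product. Evaluating at `U` gives `U*
e^{ith} U = e^{-itF} e^{ith}`, and differentiating at `t = 0` gives `U* h U - h = -F`
(`star_U_mul_mul_U_sub_of_implementedBy`). This is already a coboundary equation, but with `h`
possibly outside `C(X)`. The conditional expectation `E` onto `C(X)` cures that: it is linear,
restricts to the identity on `C(X)` (`expectation_ofFun`), and satisfies `E(U* a U) = E(a) ∘ φ`
(`expectation_star_U_mul_mul_U`). Hence `E(h) ∘ φ - E(h) = -F`, and `-Re E(h)` is the required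
function.

`E` is built from representations on `ℓ²(ℤ)`. Each point `x` gives a covariant pair: `f` acts
diagonally by its values along the orbit of `x`, and `U` acts as the bilateral shift. `E(a)(x)` is
the `(0, 0)` matrix entry of the image of `a`. Replacing `x` by `φ x` amounts to conjugating by the
shift, which is the equivariance; continuity in `x` is checked on monomials and passes to uniform
limits.

Conversely, if `F = h ∘ φ - h`, then `Ad e^{-ith}` fixes `C(X)` and sends `U` to `U e^{-itF}`. It
therefore agrees with `α^F_t` on the generators, hence everywhere. -/

/-! ## The regular representations of the crossed product -/

/-- The Hilbert space `ℓ²(ℤ)`. -/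
abbrev EllTwo : Type := lp (fun _ : ℤ => ℂ) 2

/-- The diagonal operator on `ℓ²(ℤ)` defined by a bounded sequence. -/
def diagonal (d : ℤ → ℂ) (C : ℝ) (hd : ∀ n, ‖d n‖ ≤ C) : EllTwo →L[ℂ] EllTwo :=
  -- Termwise domination by the vector `C • x` yields both square-summability and the operator bound
  -- `C`.
  have hC : ∀ (x : EllTwo) (n : ℤ), ‖d n * x n‖ ≤ ‖((C : ℂ) • x : EllTwo) n‖ := fun x n => by
    have h0 : 0 ≤ C := (norm_nonneg _).trans (hd 0)
    rw [lp.coeFn_smul, Pi.smul_apply, norm_smul, norm_mul, Complex.norm_real,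
      Real.norm_of_nonneg h0]
    exact mul_le_mul_of_nonneg_right (hd n) (norm_nonneg _)
  LinearMap.mkContinuous
    { toFun := fun x => ⟨fun n => d n * x n, (lp.memℓp ((C : ℂ) • x)).mono' (hC x)⟩
      map_add' := fun x y => lp.ext (funext fun n => mul_add _ _ _)
      map_smul' := fun c x => lp.ext (funext fun n => mul_left_comm _ _ _) }
    C fun x => by
      have h0 : 0 ≤ C := (norm_nonneg _).trans (hd 0)
      refine (lp.norm_mono two_ne_zero (hC x)).trans_eq ?_
      rw [norm_smul, Complex.norm_real, Real.norm_of_nonneg h0]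

theorem diagonal_apply (d : ℤ → ℂ) (C : ℝ) (hd : ∀ n, ‖d n‖ ≤ C) (x : EllTwo) (n : ℤ) :
    diagonal d C hd x n = d n * x n := rfl

/-- The translation operator `(S x) n = x (n - k)` on `ℓ²(ℤ)`. -/
def shift (k : ℤ) : EllTwo →L[ℂ] EllTwo :=
  have h2 : 0 < (2 : ENNReal).toReal := by norm_num
  have hx : ∀ x : EllTwo, Memℓp (fun n => x (n - k)) 2 := fun x =>
    (memℓp_gen_iff h2).2
      ((Equiv.subRight k).summable_iff.2 ((memℓp_gen_iff h2).1 (lp.memℓp x)))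
  LinearMap.mkContinuous
    { toFun := fun x => ⟨fun n => x (n - k), hx x⟩
      map_add' := fun _ _ => rfl
      map_smul' := fun _ _ => rfl }
    1 fun x => by
      rw [one_mul]
      refine lp.norm_le_of_tsum_le h2 (norm_nonneg x) ?_
      rw [lp.norm_rpow_eq_tsum h2]
      exact ((Equiv.subRight k).tsum_eq fun n => ‖x n‖ ^ (2 : ENNReal).toReal).le

theorem shift_apply (k : ℤ) (x : EllTwo) (n : ℤ) : shift k x n = x (n - k) := rfl

theorem star_shift (k : ℤ) : star (shift k) = shift (-k) := by
  refine ((ContinuousLinearMap.eq_adjoint_iff _ _).2 fun x y => ?_).symm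
  -- The substitution `n ↦ n - k` in the first sum matches the two inner products term by term.
  rw [lp.inner_eq_tsum, lp.inner_eq_tsum, ← (Equiv.subRight k).tsum_eq]
  simp [shift_apply]

theorem shift_mul_shift (k l : ℤ) : shift k * shift l = shift (k + l) := by
  refine ContinuousLinearMap.ext fun x => lp.ext (funext fun n => ?_)
  rw [mul_apply_eq_comp, shift_apply, shift_apply, shift_apply, sub_sub]

theorem shift_zero : shift 0 = 1 := by
  refine ContinuousLinearMap.ext fun x => lp.ext (funext fun n => ?_)
  rw [shift_apply, sub_zero]
  rfl

/-- The bilateral shift as a unitary operator. -/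
def shiftUnitary : unitary (EllTwo →L[ℂ] EllTwo) :=
  ⟨shift 1, by
    rw [Unitary.mem_iff, star_shift, shift_mul_shift, shift_mul_shift]
    simp [shift_zero]⟩

theorem coe_shiftUnitary : (shiftUnitary : EllTwo →L[ℂ] EllTwo) = shift 1 := rfl

/-! ### Covariant pairs attached to orbits -/

section Representation

variable {X : Type*} [TopologicalSpace X] [CompactSpace X] (φ : X ≃ₜ X)

/-- The representation of `C(X)` on `ℓ²(ℤ)` by evaluation along the orbit of `x`. -/
def orbitRep (x : X) : C(X, ℂ) →⋆ₐ[ℂ] (EllTwo →L[ℂ] EllTwo) where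
  toFun f := diagonal (fun n => f ((φ ^ n : X ≃ₜ X) x)) ‖f‖ fun _ => f.norm_coe_le_norm _
  map_one' := ContinuousLinearMap.ext fun y => lp.ext (funext fun n => one_mul (y n))
  map_mul' f g := ContinuousLinearMap.ext fun y => lp.ext (funext fun n => mul_assoc _ _ _)
  map_zero' := ContinuousLinearMap.ext fun y => lp.ext (funext fun n => zero_mul (y n))
  map_add' f g := ContinuousLinearMap.ext fun y => lp.ext (funext fun n => add_mul _ _ _)
  commutes' c := ContinuousLinearMap.ext fun y => lp.ext (funext fun n => by
    rw [diagonal_apply, Algebra.algebraMap_eq_smul_one, Algebra.algebraMap_eq_smul_one]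
    simp)
  map_star' f := by
    refine (ContinuousLinearMap.eq_adjoint_iff _ _).2 fun y z => ?_
    rw [lp.inner_eq_tsum, lp.inner_eq_tsum]
    refine tsum_congr fun n => ?_
    rw [diagonal_apply, diagonal_apply]
    simp
    ring

theorem orbitRep_apply (x : X) (f : C(X, ℂ)) (y : EllTwo) (n : ℤ) :
    orbitRep φ x f y n = f ((φ ^ n : X ≃ₜ X) x) * y n := rfl

/-- Conjugation by the shift moves the diagonal entry at `n - 1` to position `n`, and `f (φ^(n-1)
x)` is the value of `f ∘ φ⁻¹` at `φ^n x`. -/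
theorem isCovariant_orbitRep (x : X) : IsCovariant φ (orbitRep φ x) shiftUnitary := by
  intro f
  refine ContinuousLinearMap.ext fun y => lp.ext (funext fun n => ?_)
  rw [coe_shiftUnitary, star_shift, mul_apply_eq_comp, mul_apply_eq_comp,
    shift_apply, orbitRep_apply, shift_apply, orbitRep_apply, sub_neg_eq_add, sub_add_cancel,
    sub_eq_neg_add, zpow_add, zpow_neg_one]
  rfl

/-- The regular representation of the crossed product on `ℓ²(ℤ)` defined by the point `x`. -/
def regularRep (x : X) : CrossedProduct φ →⋆ₐ[ℂ] (EllTwo →L[ℂ] EllTwo) :=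
  lift (isCovariant_orbitRep φ x)

theorem regularRep_ofFun (x : X) (f : C(X, ℂ)) :
    regularRep φ x (ofFun φ f) = orbitRep φ x f := lift_ofFun _ f

theorem regularRep_U (x : X) :
    regularRep φ x (U φ : CrossedProduct φ) = shift 1 := lift_U _

/-- The orbit of `φ x` is the orbit of `x` with its origin moved by one step, so the two
representations are intertwined by the shift. Both sides are ⋆-homomorphisms in `a`, so it suffices
to compare them on `C(X)` and on `U`. -/
theorem regularRep_star_U_mul_mul_U (x : X) (a : CrossedProduct φ) :
    regularRep φ x (star (U φ : CrossedProduct φ) * a * (U φ : CrossedProduct φ)) =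
      regularRep φ (φ x) a := by
  have h : (regularRep φ x).comp
      ((Unitary.conjStarAlgAut ℂ (CrossedProduct φ) (star (U φ))).toStarAlgHom) =
        regularRep φ (φ x) := by
    refine hom_ext (fun f => ?_) ?_
    · change regularRep φ x ((star (U φ) : CrossedProduct φ) * _ * star (star _)) = _
      rw [star_star, map_mul, map_mul, map_star, regularRep_U, regularRep_ofFun,
        regularRep_ofFun, star_shift]
      refine ContinuousLinearMap.ext fun y => lp.ext (funext fun n => ?_)
      rw [mul_apply_eq_comp, mul_apply_eq_comp,
        shift_apply, orbitRep_apply, shift_apply, orbitRep_apply, sub_neg_eq_add,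
        add_sub_cancel_right, zpow_add, zpow_one]
      rfl
    · change regularRep φ x ((star (U φ) : CrossedProduct φ) * _ * star (star _)) = _
      rw [star_star, Unitary.coe_star_mul_self, one_mul, regularRep_U, regularRep_U]
  rw [← h]
  change _ = regularRep φ x ((star (U φ) : CrossedProduct φ) * _ * star (star _))
  rw [star_star]

/-! ## The conditional expectation onto `C(X)` -/

/-- The value at `x` of the canonical conditional expectation of the crossed product onto `C(X)`,
that is, the vector state at `δ₀` of the regular representation defined by `x`. -/
def expectation (a : CrossedProduct φ) (x : X) : ℂ :=
  inner ℂ (lp.single 2 (0 : ℤ) (1 : ℂ) : EllTwo) (regularRep φ x a (lp.single 2 (0 : ℤ) (1 : ℂ)))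

theorem expectation_sub (a b : CrossedProduct φ) (x : X) :
    expectation φ (a - b) x = expectation φ a x - expectation φ b x := by
  simp only [expectation, map_sub, _root_.sub_apply, inner_sub_right]

theorem expectation_add (a b : CrossedProduct φ) (x : X) :
    expectation φ (a + b) x = expectation φ a x + expectation φ b x := by
  simp only [expectation, map_add, _root_.add_apply, inner_add_right]

/-- The vector `δ₀` has norm one and ⋆-homomorphisms are contractive. The bound is uniform in `x`,
which is what the continuity proof below needs. -/
theorem norm_expectation_le (a : CrossedProduct φ) (x : X) : ‖expectation φ a x‖ ≤ ‖a‖ := by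
  have h1 : ‖(lp.single 2 (0 : ℤ) (1 : ℂ) : EllTwo)‖ = 1 := by
    rw [lp.norm_single two_pos, norm_one]
  refine (norm_inner_le_norm _ _).trans ?_
  rw [h1, one_mul]
  refine (ContinuousLinearMap.le_opNorm _ _).trans ?_
  rw [h1, mul_one]
  exact NonUnitalStarAlgHom.norm_apply_le (regularRep φ x) a

/-- The diagonal entry at `0` is `f (φ^0 x)`. -/
theorem expectation_ofFun (f : C(X, ℂ)) (x : X) : expectation φ (ofFun φ f) x = f x := by
  rw [expectation, regularRep_ofFun, lp.inner_single_left, orbitRep_apply, lp.single_apply_self]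
  simp

theorem expectation_star_U_mul_mul_U (a : CrossedProduct φ) (x : X) :
    expectation φ (star (U φ : CrossedProduct φ) * a * (U φ : CrossedProduct φ)) x =
      expectation φ a (φ x) := by
  rw [expectation, regularRep_star_U_mul_mul_U, expectation]

theorem continuous_expectation (a : CrossedProduct φ) : Continuous (expectation φ a) := by
  induction a using cp_induction with
  | hp =>
    -- Norm convergence in the crossed product forces uniform convergence of the expectations, and
    -- uniform limits of continuous functions are continuous.
    rw [← isSeqClosed_iff_isClosed]
    intro b a hb ha
    refine continuous_of_uniform_approx_of_continuous fun u hu => ?_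
    obtain ⟨ε, hε, hεu⟩ := Metric.mem_uniformity_dist.1 hu
    obtain ⟨n, hn⟩ := ((Metric.tendsto_nhds.1 ha) ε hε).exists
    refine ⟨expectation φ (b n), hb n, fun x => hεu ?_⟩
    rw [dist_eq_norm, ← expectation_sub]
    refine (norm_expectation_le φ _ x).trans_lt ?_
    rwa [← dist_eq_norm, dist_comm]
  | h a =>
    induction a using alg_induction with
    | h0 =>
      refine (continuous_const (y := (0 : ℂ))).congr fun x => ?_
      simp [expectation]
    | ha a b h1 h2 =>
      rw [map_add]
      exact (h1.add h2).congr fun x => (expectation_add φ _ _ x).symm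
    | hs n f =>
      obtain ⟨f, rfl⟩ := toCoef_surjective f
      -- On `f Uⁿ` the point `x` enters only through `f x`: the other factor is the entry at `0` of
      -- the shifted vector `Sⁿ δ₀`, a constant.
      have h : ∀ x, expectation φ (toCP φ (single n (toCoef φ f))) x = f x *
          ((shiftUnitary ^ n.toAdd : unitary (EllTwo →L[ℂ] EllTwo)) : EllTwo →L[ℂ] EllTwo)
            (lp.single 2 (0 : ℤ) (1 : ℂ)) 0 := fun x => by
        rw [expectation, hom_toCP_single _ shiftUnitary (regularRep_U φ x), regularRep_ofFun,
          mul_apply_eq_comp, lp.inner_single_left, orbitRep_apply]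
        simp
      simp only [funext h]
      exact f.continuous.mul continuous_const

/-- The real part of the conditional expectation of `a`, an element of `C(X)`. -/
def realExpectation (a : CrossedProduct φ) : C(X, ℝ) :=
  ⟨fun x => (expectation φ a x).re, Complex.continuous_re.comp (continuous_expectation φ a)⟩

theorem realExpectation_apply (a : CrossedProduct φ) (x : X) :
    realExpectation φ a x = (expectation φ a x).re := rfl

/-! ## Inner flows and coboundaries -/

variable (F : C(X, ℝ))

theorem star_U_mul_ofFun_mul_U (f : C(X, ℂ)) :
    star (U φ : CrossedProduct φ) * ofFun φ f * (U φ : CrossedProduct φ) =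
      ofFun φ (f.comp (φ : C(X, X))) := by
  have h := U_mul_ofFun_mul_star (φ := φ) (f.comp (φ : C(X, X)))
  have h' : (f.comp (φ : C(X, X))).comp (φ.symm : C(X, X)) = f :=
    ContinuousMap.ext fun x => congrArg f (φ.apply_symm_apply x)
  rw [h'] at h
  rw [← h]
  simp only [← mul_assoc, Unitary.coe_star_mul_self, one_mul]
  rw [mul_assoc, Unitary.coe_star_mul_self, mul_one]

/-! ### Exponentials of functions, and the derivative of an inner flow -/

theorem exp_toComplex (t : ℝ) :
    NormedSpace.exp ((Complex.I * t) • toComplex F) = phase F (-t) := by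
  ext x
  -- Evaluation at a point is a continuous homomorphism, so it commutes with the exponential series.
  -- The time is `-t` because `phase` carries a minus sign in its exponent.
  have h := NormedSpace.map_exp (ContinuousMap.evalAlgHom ℂ ℂ x)
    (continuous_eval_const x) ((Complex.I * t) • toComplex F)
  refine h.trans ?_
  rw [← Complex.exp_eq_exp_ℂ]
  simp [toComplex, phase]

theorem continuous_ofFun : Continuous (ofFun φ) :=
  (AddMonoidHomClass.lipschitz_of_bound (ofFun φ) 1
    fun f => by simpa using norm_ofFun_le f).continuous

theorem exp_ofFun_toComplex (t : ℝ) :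
    NormedSpace.exp ((Complex.I * t) • ofFun φ (toComplex F)) = ofFun φ (phase F (-t)) := by
  rw [← map_smul, ← exp_toComplex]
  let _ : NormedAlgebra ℚ (CrossedProduct φ) := NormedAlgebra.restrictScalars ℚ ℂ _
  exact (NormedSpace.map_exp (ofFun φ) (continuous_ofFun φ) _).symm

theorem exp_neg_ofFun_toComplex (t : ℝ) :
    NormedSpace.exp (-((Complex.I * t) • ofFun φ (toComplex F))) = ofFun φ (phase F t) := by
  have h := exp_ofFun_toComplex φ F (-t)
  rwa [Complex.ofReal_neg, mul_neg, neg_smul, neg_neg] at h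

/-- The infinitesimal form of `α^F = Ad e^{ith}`. -/
theorem star_U_mul_mul_U_sub_of_implementedBy {h : CrossedProduct φ}
    (hh : (potentialFlow φ F).ImplementedBy h) :
    star (U φ : CrossedProduct φ) * h * (U φ : CrossedProduct φ) - h =
      -ofFun φ (toComplex F) := by
  set u : CrossedProduct φ := (U φ : CrossedProduct φ)
  set k : CrossedProduct φ := ofFun φ (toComplex F)
  -- The factor `i` is absorbed into the generator, leaving one-parameter groups in the real
  -- variable `t`.
  have hs : ∀ (t : ℝ) (a : CrossedProduct φ), (Complex.I * t) • a = t • (Complex.I • a) :=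
    fun t a => by rw [mul_comm, mul_smul, Complex.coe_smul]
  -- The relation `e^{ith} U e^{-ith} = U e^{-itF}`, multiplied on the right by `e^{ith}`, leaves a
  -- single varying factor on the left and two on the right.
  have hexp : ∀ t : ℝ, NormedSpace.exp (t • (Complex.I • h)) * u =
      u * NormedSpace.exp (t • -(Complex.I • k)) * NormedSpace.exp (t • (Complex.I • h)) :=
    fun t => by
      have h1 : u * NormedSpace.exp (t • -(Complex.I • k)) =
          NormedSpace.exp (t • (Complex.I • h)) * u *
            NormedSpace.exp (-(t • (Complex.I • h))) := by
        rw [← hs, ← hh t u, smul_neg, ← hs, exp_neg_ofFun_toComplex]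
        exact (flowHom_U φ F t).symm
      let _ : NormedAlgebra ℚ (CrossedProduct φ) := NormedAlgebra.restrictScalars ℚ ℂ _
      rw [h1, mul_assoc, ← NormedSpace.exp_add_of_commute (Commute.neg_left (Commute.refl _)),
        neg_add_cancel, NormedSpace.exp_zero, mul_one]
  have hd : ∀ a : CrossedProduct φ,
      HasDerivAt (fun t : ℝ => NormedSpace.exp (t • a)) a 0 := fun a => by
    simpa using hasDerivAt_exp_smul_const (𝕂 := ℝ) a 0
  have hl := (hd (Complex.I • h)).mul_const u
  have hr := ((hd (-(Complex.I • k))).const_mul u).mul (hd (Complex.I • h))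
  -- Both sides of `hexp` are the same function of `t`, so their derivatives at `0` coincide; this
  -- is `hU = U(h - F)` up to the factor `i`.
  have heq := hl.unique (hr.congr_of_eventuallyEq (Filter.Eventually.of_forall hexp))
  simp only [zero_smul, NormedSpace.exp_zero, mul_one] at heq
  have hI : h * u = u * (h - k) := by
    refine smul_right_injective _ Complex.I_ne_zero ?_
    change Complex.I • (h * u) = Complex.I • (u * (h - k))
    rw [← smul_mul_assoc, heq, mul_sub, smul_sub, mul_neg, mul_smul_comm, mul_smul_comm]
    abel
  rw [mul_assoc, hI, ← mul_assoc, Unitary.coe_star_mul_self, one_mul]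
  abel

/-- Applying the expectation at `x` to `U* h U - h = -F` turns conjugation by `U` into composition
with `φ`. Since `F` is real, taking real parts preserves the equation and gives a real solution at
once. -/
theorem coboundary_of_isInner (hF : (potentialFlow φ F).IsInner) :
    ∃ h : C(X, ℝ), ∀ x, F x = h (φ x) - h x := by
  obtain ⟨h, -, hh⟩ := hF
  refine ⟨-realExpectation φ h, fun x => ?_⟩
  have key := congrArg (fun a => (expectation φ a x).re)
    (star_U_mul_mul_U_sub_of_implementedBy φ F hh)
  simp only [expectation_sub, expectation_star_U_mul_mul_U, ← map_neg (ofFun φ),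
    expectation_ofFun, Complex.sub_re] at key
  have hFx : ((-toComplex F) x).re = -F x := by simp [toComplex]
  rw [hFx] at key
  simp only [ContinuousMap.neg_apply, realExpectation_apply]
  linarith

/-! ### From a coboundary to an implementing function -/

theorem isSelfAdjoint_ofFun_toComplex (h : C(X, ℝ)) :
    IsSelfAdjoint (ofFun φ (toComplex h)) := by
  refine IsSelfAdjoint.map ?_ (ofFun φ)
  ext x
  simp [toComplex]

/-- The sign comes from `e^{-ith} U e^{ith} = U e^{-it(h ∘ φ)} e^{ith} = U e^{-itF}`: the
implementing function is `-h`. -/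
theorem implementedBy_of_coboundary {h : C(X, ℝ)} (hh : ∀ x, F x = h (φ x) - h x) :
    (potentialFlow φ F).ImplementedBy (ofFun φ (toComplex (-h))) := by
  intro t a
  rw [exp_ofFun_toComplex, exp_neg_ofFun_toComplex]
  set w : unitary (CrossedProduct φ) := unitaryMap (ofFun φ) (phaseUnitary (-h) (-t))
  have hw : (w : CrossedProduct φ) = ofFun φ (phase (-h) (-t)) := rfl
  have hw' : star (w : CrossedProduct φ) = ofFun φ (phase (-h) t) := by
    rw [hw, ← map_star, star_phase, neg_neg]
  have hom : flowHom φ F t =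
      (Unitary.conjStarAlgAut ℂ (CrossedProduct φ) w).toStarAlgHom := by
    -- On `C(X)` both maps are the identity, since `w` lies in the commutative image of `C(X)`; only
    -- the value at `U` involves `hh`.
    refine hom_ext (fun f => ?_) ?_
    · change _ = (w : CrossedProduct φ) * ofFun φ f * star (w : CrossedProduct φ)
      rw [flowHom_ofFun, hw', hw, ← map_mul, ← map_mul, mul_right_comm, ← phase_add,
        neg_add_cancel, phase_zero, one_mul]
    · change _ = (w : CrossedProduct φ) * (U φ : CrossedProduct φ) * star (w : CrossedProduct φ)
      -- Moving a function from the left of `U` to its right composes it with `φ`, which produces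
      -- the term `h ∘ φ`.
      have hconj : ofFun φ (phase (-h) (-t)) * (U φ : CrossedProduct φ) =
          (U φ : CrossedProduct φ) * ofFun φ ((phase (-h) (-t)).comp (φ : C(X, X))) := by
        rw [← star_U_mul_ofFun_mul_U, ← mul_assoc, ← mul_assoc, ← Unitary.coe_star,
          Unitary.coe_mul_star_self, one_mul]
      rw [flowHom_U, hw', hw, hconj, mul_assoc, ← map_mul]
      congr 2
      ext x
      simp only [phase, ContinuousMap.coe_mk, ContinuousMap.mul_apply, ContinuousMap.comp_apply,
        ← Complex.exp_add, hh x, ContinuousMap.neg_apply]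
      congr 1
      push_cast
      change _ = -(Complex.I * -(t : ℂ) * -(h (φ x) : ℂ)) + _
      ring
  rw [← hw', ← hw]
  exact congrArg (fun ρ : CrossedProduct φ →⋆ₐ[ℂ] CrossedProduct φ => ρ a) hom

end Representation

end ZCrossedProduct

end

/-- For a homeomorphism `φ` of a compact metric space `X` and a real-valued `F ∈ C(X)`, the flow
`α^F` on `C(X) ⋊_φ ℤ` is inner iff it is `Ad e^{ith}` for a real-valued `h ∈ C(X)` iff
`F = h ∘ φ - h` for a continuous `h : X → ℝ`. -/
theorem theorem2p1 {X : Type*} [MetricSpace X] [CompactSpace X] (φ : X ≃ₜ X) (F : C(X, ℝ)) :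
    List.TFAE [
      (ZCrossedProduct.potentialFlow φ F).IsInner,
      ∃ h : C(X, ℝ), (ZCrossedProduct.potentialFlow φ F).ImplementedBy
        (ZCrossedProduct.ofFun φ (ZCrossedProduct.toComplex h)),
      ∃ h : C(X, ℝ), ∀ x, F x = h (φ x) - h x] := by
  -- An arbitrary implementing element is replaced by one in `C(X)` only by way of the coboundary
  -- equation, through 1 → 3 → 2.
  tfae_have 3 → 2 := fun ⟨h, hh⟩ =>
    ⟨-h, ZCrossedProduct.implementedBy_of_coboundary φ F hh⟩
  tfae_have 2 → 1 := fun ⟨h, hh⟩ =>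
    ⟨_, ZCrossedProduct.isSelfAdjoint_ofFun_toComplex φ h, hh⟩
  tfae_have 1 → 3 := ZCrossedProduct.coboundary_of_isInner φ F
  tfae_finish
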